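/- Logarithms are to base $2$, $|A|=\sqrt{A^\dagger A}$ and $\|A\|_{\mathrm{tr}}=\tfrac12\operatorname{tr}|A|$. For a density operator $\rho$ let $H_\infty(\rho)=-\log\lambda_{\max}(\rho)$, where $\lambda_{\max}(\rho)$ is the largest eigenvalue of $\rho$. Let $n\ge 0$ be an integer, and let $\mathcal E$ be a completely positive trace-preserving linear map from operators on $\mathbb C^{2^n}$ to operators on $\mathbb C^{d}$ ($d\geq 1$; the length-preserving case is $d=2^n$) with $\mathcal E(\mathbb I/2^n)=\mathbb I/d$. (An encryption scheme, averaged over its secret key, is such a map; no further property of it is used.) For real $t,\varepsilon$: - $\mathcal E$ is $(t,\varepsilon)$-indistinguishable if $\|\mathcal E(\rho)-\mathbb I/d\|_{\mathrm{tr}}<\varepsilon$ for every density operator $\rho$ on $\mathbb C^{2^n}$ with $H_\infty(\rho)\ge t$. - $\mathcal E$ is strongly $(t,\varepsilon)$-entropically secure if for every density operator $\rho$ on $\mathbb C^{2^n}$ with $H_\infty(\rho)\ge t$, every finite ensemble $\{(p_i,\sigma_i)\}$ of density operators with probabilities $p_i>0$, $\sum_i p_i=1$ and $\sum_i p_i\sigma_i=\rho$,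 every finite set $Z$, every POVM $A=\{A_z\}_{z\in Z}$ on $\mathbb C^d$ and every function $f$ from density operators on $\mathbb C^{2^n}$ to $Z$, $$\Big|\Pr_i[A(\mathcal E(\sigma_i))=f(\sigma_i)]-\Pr_i[A(\mathcal E(\rho))=f(\sigma_i)]\Big|<\varepsilon ,$$ where $i$ is drawn with probability $p_i$ and $A$ outputs $z$ on $\gamma$ with probability $\operatorname{tr}(A_z\gamma)$; that is, $\big|\sum_i p_i\operatorname{tr}\big(A_{f(\sigma_i)}\mathcal E(\sigma_i)\big)-\sum_i p_i\operatorname{tr}\big(A_{f(\sigma_i)}\mathcal E(\rho)\big)\big|<\varepsilon$. **Theorem.** Let $t,\varepsilon$ be real numbers with $t\le n-1$. 1. If $\mathcal E$ is strongly $(t,\varepsilon)$-entropically secure, then $\mathcal E$ is $(t-1,2\varepsilon)$-indistinguishable, i.e. $\|\mathcal E(\rho)-\mathbb I/d\|_{\mathrm{tr}}<2\varepsilon$ for every density operator $\rho$ with $H_\infty(\rho)\ge t-1$. 2. If $\mathcal E$ is $(t-1,\varepsilon/8)$-indistinguishable, then $\mathcal E$ is strongly $(t,\varepsilon)$-entropically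 secure (for all functions $f$, not just predicates). -/

import Mathlib

open scoped MatrixOrder ComplexOrder

namespace QEntropic

noncomputable section

/-- A (physical) state: a density operator on `ℂ^ι`, i.e. a positive semidefinite matrix of
trace one. -/
structure DensityOp (ι : Type*) [Fintype ι] where
  /-- the underlying matrix -/
  mat : Matrix ι ι ℂ
  posSemidef : mat.PosSemidef
  trace_eq_one : mat.trace = 1

/-- The matrix `I / d`, where `d` is the dimension of `ℂ^ι`. -/
def maxMixed (ι : Type*) [Fintype ι] [DecidableEq ι] : Matrix ι ι ℂ :=
  ((Fintype.card ι : ℂ)⁻¹) • (1 : Matrix ι ι ℂ)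

/-- The min-entropy `H_∞(ρ) = - log₂ (max_j γ_j)`, where the `γ_j` are the eigenvalues of `ρ`. -/
def DensityOp.minEntropy {ι : Type*} [Fintype ι] [DecidableEq ι] (ρ : DensityOp ι) : ℝ :=
  - Real.logb 2 (⨆ j, ρ.posSemidef.isHermitian.eigenvalues j)

/-- The trace norm with the normalisation `‖A‖_tr = (1/2) tr |A|`, where `|A| = √(A† A)`. -/
def trNorm {ι : Type*} [Fintype ι] [DecidableEq ι] (A : Matrix ι ι ℂ) : ℝ :=
  (1 / 2) * (CFC.sqrt (A.conjTranspose * A)).trace.re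

/-- The extension `Φ ⊗ id_k` of a linear map `Φ` on matrices: `Φ` is applied to each of the
`k × k` blocks of the argument. -/
def ampliation {ι κ : Type*} (Φ : Matrix ι ι ℂ →ₗ[ℂ] Matrix κ κ ℂ) (k : ℕ)
    (M : Matrix (ι × Fin k) (ι × Fin k) ℂ) : Matrix (κ × Fin k) (κ × Fin k) ℂ :=
  Matrix.of fun x y => Φ (Matrix.of fun i j => M (i, x.2) (j, y.2)) x.1 y.1

/-- A super-operator (quantum channel): a completely positive, trace preserving linear map. -/
structure Channel (ι κ : Type*) [Fintype ι] [Fintype κ] where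
  /-- the underlying linear map -/
  map : Matrix ι ι ℂ →ₗ[ℂ] Matrix κ κ ℂ
  completelyPositive : ∀ (k : ℕ) (M : Matrix (ι × Fin k) (ι × Fin k) ℂ),
    M.PosSemidef → (ampliation map k M).PosSemidef
  tracePreserving : ∀ M : Matrix ι ι ℂ, (map M).trace = M.trace

/-- An interpretation of `ρ`: a finite ensemble `{(p_i, σ_i)}` of states with non-zero
probabilities such that `ρ = ∑ i, p_i σ_i`. -/
structure Interpretation {ι : Type*} [Fintype ι] (ρ : DensityOp ι) (N : ℕ) where
  /-- the probabilities -/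
  p : Fin N → ℝ
  /-- the messages -/
  σ : Fin N → DensityOp ι
  p_pos : ∀ i, 0 < p i
  p_sum : ∑ i, p i = 1
  mixture : ∑ i, (p i : ℂ) • (σ i).mat = ρ.mat

/-- An adversary: a POVM on `ℂ^κ` with outcomes in the finite set `Z`. -/
structure POVM (κ Z : Type*) [Fintype κ] [DecidableEq κ] [Fintype Z] where
  /-- the POVM elements -/
  elem : Z → Matrix κ κ ℂ
  posSemidef : ∀ z, (elem z).PosSemidef
  sum_eq_one : ∑ z, elem z = 1

/-- The probability that the measurement `A` outputs `z` on the system described by `γ`. -/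
def POVM.prob {κ Z : Type*} [Fintype κ] [DecidableEq κ] [Fintype Z] (A : POVM κ Z)
    (γ : Matrix κ κ ℂ) (z : Z) : ℝ :=
  (A.elem z * γ).trace.re

/-- `(t, ε)`-indistinguishability of `E`: `‖E(ρ) - I/d‖_tr < ε` for all states `ρ` with
`H_∞(ρ) ≥ t`. -/
def Indistinguishable {ι κ : Type*} [Fintype ι] [DecidableEq ι] [Fintype κ] [DecidableEq κ]
    (E : Channel ι κ) (t ε : ℝ) : Prop :=
  ∀ ρ : DensityOp ι, t ≤ ρ.minEntropy → trNorm (E.map ρ.mat - maxMixed κ) < ε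

/-- Strong `(t, ε)`-entropic security of `E`: for all states `ρ` with `H_∞(ρ) ≥ t`, all
interpretations `{(p_i, σ_i)}` of `ρ`, all adversaries `A` and all functions `f` on states
(with values in an arbitrary finite set `Z`, for instance bit strings of some length),
`|Pr_i[A(E(σ_i)) = f(σ_i)] - Pr_i[A(E(ρ)) = f(σ_i)]| < ε`. -/
def StronglyEntropicallySecure {ι κ : Type*} [Fintype ι] [DecidableEq ι]
    [Fintype κ] [DecidableEq κ] (E : Channel ι κ) (t ε : ℝ) : Prop :=
  ∀ ρ : DensityOp ι, t ≤ ρ.minEntropy →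
  ∀ (N : ℕ) (I : Interpretation ρ N)
    (Z : Type) [Fintype Z] (A : POVM κ Z) (f : DensityOp ι → Z),
    |∑ i, I.p i * A.prob (E.map (I.σ i).mat) (f (I.σ i))
      - ∑ i, I.p i * A.prob (E.map ρ.mat) (f (I.σ i))| < ε

end

end QEntropic

namespace QEntropic

open Matrix

/-! Min-entropy at least `t` means `ρ ≤ s • 1` with `s = 2 ^ (-t)`, an inequality that behaves well
under mixing. Security to indistinguishability: a state `ρ ≤ 2s` is balanced by a multiple `τ` of
`2s - ρ`. Since `E` fixes the maximally mixed state, the deviations of `E ρ` and `E τ` from it are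
opposite, so guessing which of the two was sent, by the optimal measurement, has advantage at least
`‖E ρ - I/d‖ / 2`. Converse: a sub-ensemble of `ρ`, padded with the maximally mixed state, has
entropy at least `t - 1`, so no event of the ensemble correlates with an effect
(`Indistinguishable.abs_sum_lt`). A general `f` reduces to events `f ∈ S` by averaging over all `S ⊆
Z` (`sum_finset_ite_mem_sum`), at the cost of a factor 4. -/

lemma posSemidef_ofReal_smul {ι : Type*} {A : Matrix ι ι ℂ} (hA : A.PosSemidef) {c : ℝ} (hc : 0 ≤ c) :
    ((c : ℂ) • A).PosSemidef :=
  hA.smul (Complex.zero_le_real.mpr hc)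

section Positivity

variable {ι κ : Type*} [Fintype ι] [Fintype κ]

lemma DensityOp.nonempty (ρ : DensityOp ι) : Nonempty ι := by
  by_contra h
  rw [not_nonempty_iff] at h
  have := ρ.trace_eq_one
  simp [Matrix.trace] at this

/-- A channel maps positive semidefinite matrices to positive semidefinite matrices. -/
lemma Channel.map_posSemidef (E : Channel ι κ) {M : Matrix ι ι ℂ} (hM : M.PosSemidef) :
    (E.map M).PosSemidef := by
  have h := E.completelyPositive 1 (M.submatrix Prod.fst Prod.fst) (hM.submatrix Prod.fst)
  exact h.submatrix (fun i => (i, 0))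

lemma Channel.nonempty_right (E : Channel ι κ) (ρ : DensityOp ι) : Nonempty κ := by
  by_contra h
  rw [not_nonempty_iff] at h
  have := E.tracePreserving ρ.mat
  rw [ρ.trace_eq_one] at this
  simp [Matrix.trace] at this

end Positivity

/-! ### Trace norm, effects and min-entropy -/

section Matrices

variable {ι : Type*} [Fintype ι] [DecidableEq ι]

lemma re_trace_mul_nonneg {A B : Matrix ι ι ℂ} (hA : A.PosSemidef) (hB : B.PosSemidef) :
    0 ≤ (A * B).trace.re := by
  obtain ⟨C, rfl⟩ := CStarAlgebra.nonneg_iff_eq_star_mul_self.mp hB.nonneg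
  have h : (A * (star C * C)).trace = (C * A * Cᴴ).trace := by
    rw [← mul_assoc, trace_mul_comm, ← mul_assoc]; rfl
  rw [h]
  exact (Complex.le_def.mp (hA.mul_mul_conjTranspose_same C).trace_nonneg).1

lemma trNorm_eq_re_trace_posPart {H : Matrix ι ι ℂ} (hH : H.IsHermitian) (htr : H.trace = 0) :
    trNorm H = (H⁺).trace.re ∧ (H⁻).trace.re = (H⁺).trace.re := by
  have hsa : IsSelfAdjoint H := hH
  have h1 : CFC.sqrt (Hᴴ * H) = H⁺ + H⁻ := (CFC.posPart_add_negPart H hsa).symm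
  have h2 : (H⁺).trace - (H⁻).trace = 0 := by
    rw [← trace_sub, CFC.posPart_sub_negPart H hsa, htr]
  have h3 : (H⁻).trace = (H⁺).trace := (sub_eq_zero.mp h2).symm
  refine ⟨?_, by rw [h3]⟩
  rw [trNorm, h1, trace_add, h3, Complex.add_re]
  ring

/-- A measurement operator distinguishes at most as well as the trace norm. -/
lemma abs_re_trace_mul_le_trNorm {A H : Matrix ι ι ℂ} (hA : A.PosSemidef)
    (hA' : (1 - A).PosSemidef) (hH : H.IsHermitian) (htr : H.trace = 0) :
    |(A * H).trace.re| ≤ trNorm H := by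
  obtain ⟨h1, h2⟩ := trNorm_eq_re_trace_posPart hH htr
  have hp : (H⁺).PosSemidef := nonneg_iff_posSemidef.mp (CFC.posPart_nonneg H)
  have hn : (H⁻).PosSemidef := nonneg_iff_posSemidef.mp (CFC.negPart_nonneg H)
  have e : (A * H).trace.re = (A * H⁺).trace.re - (A * H⁻).trace.re := by
    conv_lhs => rw [← CFC.posPart_sub_negPart H hH]
    rw [mul_sub, trace_sub, Complex.sub_re]
  -- Both `tr (A H⁺)` and `tr (A H⁻)` lie between 0 and `tr H⁺ = tr H⁻`, hence so does the absolute
  -- value of their difference.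
  have b1 := re_trace_mul_nonneg hA hp
  have b2 := re_trace_mul_nonneg hA hn
  have b3 := re_trace_mul_nonneg hA' hp
  have b4 := re_trace_mul_nonneg hA' hn
  rw [sub_mul, one_mul, trace_sub, Complex.sub_re] at b3 b4
  rw [e, abs_le]
  constructor <;> linarith

/-- The trace norm is attained by the projection onto the positive eigenspaces. -/
lemma exists_re_trace_mul_eq_trNorm {H : Matrix ι ι ℂ} (hH : H.IsHermitian)
    (htr : H.trace = 0) :
    ∃ P : Matrix ι ι ℂ, P.PosSemidef ∧ (1 - P).PosSemidef ∧ (P * H).trace.re = trNorm H := by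
  have hsa : IsSelfAdjoint H := hH
  -- The indicator `f` below is discontinuous, but the spectrum is finite.
  have hc (g : ℝ → ℝ) : ContinuousOn g (spectrum ℝ H) :=
    Matrix.finite_real_spectrum.continuousOn g
  set f : ℝ → ℝ := fun x => if 0 < x then 1 else 0
  refine ⟨cfc f H, ?_, ?_, ?_⟩
  · exact nonneg_iff_posSemidef.mp (cfc_nonneg fun x _ => by simp only [f]; split_ifs <;> simp)
  · exact le_iff.mp (cfc_le_one f H fun x _ => by simp only [f]; split_ifs <;> simp)
  · have e : cfc f H * H = H⁺ := by
      rw [CFC.posPart_def, cfcₙ_eq_cfc (f := fun x : ℝ => x⁺) (hf := (continuous_posPart).continuousOn)]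
      conv_lhs => arg 2; rw [← cfc_id' ℝ H hsa]
      rw [← cfc_mul f (fun x => x) H (hc _) (hc _)]
      refine cfc_congr fun x _ => ?_
      simp only [f]
      split_ifs with h
      · simp [posPart_eq_self.mpr h.le]
      · simp [posPart_eq_zero.mpr (not_lt.mp h)]
    rw [e, (trNorm_eq_re_trace_posPart hH htr).1]

lemma trace_maxMixed [Nonempty ι] : (maxMixed ι).trace = 1 := by
  have : (Fintype.card ι : ℂ) ≠ 0 := by exact_mod_cast Fintype.card_ne_zero
  simp [maxMixed, trace_smul, this]

lemma maxMixed_posSemidef : (maxMixed ι).PosSemidef := by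
  have := posSemidef_ofReal_smul (PosSemidef.one (n := ι) (R := ℂ))
    (c := (Fintype.card ι : ℝ)⁻¹) (by positivity)
  simpa [maxMixed] using this

lemma DensityOp.le_minEntropy_iff (ρ : DensityOp ι) (t : ℝ) :
    t ≤ ρ.minEntropy ↔ ((((2 : ℝ) ^ (-t) : ℝ) : ℂ) • (1 : Matrix ι ι ℂ) - ρ.mat).PosSemidef := by
  have := ρ.nonempty
  have hH := ρ.posSemidef.isHermitian
  have hb : BddAbove (Set.range hH.eigenvalues) := Set.finite_range _ |>.bddAbove
  -- The logarithm can be inverted only at positive arguments; trace one rules out a nonpositive top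
  -- eigenvalue.
  have hpos : 0 < ⨆ j, hH.eigenvalues j := by
    by_contra hn
    have hz : ∀ j, hH.eigenvalues j ≤ 0 := fun j => (le_ciSup hb j).trans (not_lt.mp hn)
    have h1 := hH.trace_eq_sum_eigenvalues
    rw [ρ.trace_eq_one] at h1
    have h2 : (1 : ℝ) = ∑ j, hH.eigenvalues j := by
      have := congrArg Complex.re h1
      simpa using this
    have : ∑ j, hH.eigenvalues j ≤ 0 := Finset.sum_nonpos fun j _ => hz j
    linarith
  have halg : (((2 : ℝ) ^ (-t) : ℝ) : ℂ) • (1 : Matrix ι ι ℂ)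
      = algebraMap ℝ (Matrix ι ι ℂ) ((2 : ℝ) ^ (-t)) := by
    rw [Algebra.algebraMap_eq_smul_one]
    ext i j
    simp [Matrix.smul_apply]
  rw [DensityOp.minEntropy, le_neg, Real.logb_le_iff_le_rpow one_lt_two hpos, halg, ← le_iff,
    le_algebraMap_iff_spectrum_le (ha := (hH : IsSelfAdjoint ρ.mat)),
    hH.spectrum_real_eq_range_eigenvalues, ciSup_le_iff hb]
  simp

end Matrices

/-! ### Deviation from the maximally mixed state, and effects from POVMs -/

section Channels

variable {ι κ : Type*} [Fintype ι] [Fintype κ] [DecidableEq κ]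

lemma Channel.isHermitian_sub_maxMixed (E : Channel ι κ) (ρ : DensityOp ι) :
    (E.map ρ.mat - maxMixed κ).IsHermitian :=
  (E.map_posSemidef ρ.posSemidef).isHermitian.sub maxMixed_posSemidef.isHermitian

lemma Channel.trace_sub_maxMixed (E : Channel ι κ) (ρ : DensityOp ι) :
    (E.map ρ.mat - maxMixed κ).trace = 0 := by
  have := E.nonempty_right ρ
  rw [trace_sub, E.tracePreserving, ρ.trace_eq_one, trace_maxMixed, sub_self]

/-- The measurement with elements `P` and `1 - P`. -/
def POVM.ofEffect (P : Matrix κ κ ℂ) (hP : P.PosSemidef) (hP' : (1 - P).PosSemidef) :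
    POVM κ Bool where
  elem b := if b then P else 1 - P
  posSemidef b := by cases b <;> simpa
  sum_eq_one := by simp

lemma POVM.sum_posSemidef {Z : Type*} [Fintype Z] (A : POVM κ Z) (S : Finset Z) :
    (∑ z ∈ S, A.elem z).PosSemidef :=
  posSemidef_sum S fun z _ => A.posSemidef z

lemma POVM.one_sub_sum_posSemidef {Z : Type*} [Fintype Z] (A : POVM κ Z) (S : Finset Z) :
    (1 - ∑ z ∈ S, A.elem z).PosSemidef := by
  classical
  rw [← A.sum_eq_one, ← Finset.sum_add_sum_compl S, add_sub_cancel_left]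
  exact A.sum_posSemidef _

lemma POVM.prob_sub {Z : Type*} [Fintype Z] (A : POVM κ Z) (γ δ : Matrix κ κ ℂ) (z : Z) :
    A.prob (γ - δ) z = A.prob γ z - A.prob δ z := by
  simp [POVM.prob, mul_sub]

end Channels

/-! ### From functions to predicates -/

section Averaging

/-- Averaging over all subsets `S ∋ w`: the pair `(w, z)` lies in a fourth of the subsets if
`z ≠ w` and in half of them if `z = w`. -/
lemma sum_finset_ite_mem_sum {Z : Type*} [Fintype Z] [DecidableEq Z] (w : Z) (g : Z → ℝ) :
    4 * ∑ S : Finset Z, (if w ∈ S then ∑ z ∈ S, g z else 0)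
      = 2 ^ Fintype.card Z * (∑ z, g z + g w) := by
  have hcard (z : Z) : 4 * ((Finset.univ.filter fun S : Finset Z => w ∈ S ∧ z ∈ S).card : ℝ)
      = 2 ^ Fintype.card Z * (1 + if z = w then 1 else 0) := by
    have e : (Finset.univ.filter fun S : Finset Z => w ∈ S ∧ z ∈ S)
        = Finset.Icc {w, z} Finset.univ := by
      ext S
      simp [Finset.insert_subset_iff]
    have hle : ({w, z} : Finset Z).card ≤ Fintype.card Z := Finset.card_le_univ _
    rw [e, Finset.card_Icc_finset (Finset.subset_univ _), Finset.card_univ]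
    obtain ⟨k, hk⟩ := Nat.exists_eq_add_of_le hle
    rw [hk, Nat.add_sub_cancel_left]
    by_cases h : z = w
    · subst h
      simp [pow_add]
      ring
    · rw [Finset.card_pair (Ne.symm h)]
      simp [pow_add, h]
      ring
  have h1 : ∑ S : Finset Z, (if w ∈ S then ∑ z ∈ S, g z else 0)
      = ∑ z, ((Finset.univ.filter fun S : Finset Z => w ∈ S ∧ z ∈ S).card : ℝ) * g z := by
    have h2 (S : Finset Z) : (if w ∈ S then ∑ z ∈ S, g z else 0)
        = ∑ z, if w ∈ S ∧ z ∈ S then g z else 0 := by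
      by_cases hw : w ∈ S <;> simp [hw]
    simp_rw [h2]
    rw [Finset.sum_comm]
    refine Finset.sum_congr rfl fun z _ => ?_
    rw [← Finset.sum_filter, Finset.sum_const, nsmul_eq_mul]
  rw [h1, Finset.mul_sum]
  simp_rw [← mul_assoc, hcard, mul_assoc]
  rw [← Finset.mul_sum]
  simp [add_mul, Finset.sum_add_distrib]

end Averaging

/-! ### The two implications -/

section Security

variable {ι κ : Type*} [Fintype ι] [DecidableEq ι] [Fintype κ] [DecidableEq κ]

lemma two_rpow_neg_sub_one (t : ℝ) : (2 : ℝ) ^ (-(t - 1)) = 2 * 2 ^ (-t) := by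
  rw [show -(t - 1) = 1 + -t by ring, Real.rpow_add two_pos, Real.rpow_one]

/-- If `ρ ≤ 2s`, then `τ = (2s - ρ) / (2sD - 1)` is a state such that the mixture
`(ρ + τ) / 2` is bounded by `s`. -/
theorem StronglyEntropicallySecure.indistinguishable {E : Channel ι κ}
    (hE : E.map (maxMixed ι) = maxMixed κ) {t ε : ℝ}
    (ht : 2 ≤ (2 : ℝ) ^ (-t) * Fintype.card ι) (h : StronglyEntropicallySecure E t ε) :
    Indistinguishable E (t - 1) (2 * ε) := by
  intro ρ hρ
  rw [DensityOp.le_minEntropy_iff, two_rpow_neg_sub_one] at hρ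
  have := ρ.nonempty
  set s : ℝ := 2 ^ (-t) with hs
  set D : ℝ := (Fintype.card ι : ℝ) with hD
  have hD0 : D ≠ 0 := by simp [hD]
  set c : ℝ := (2 * s * D - 1)⁻¹ with hc
  have hc0 : 0 < c := inv_pos.mpr (by linarith)
  have hc1 : c ≤ 1 := inv_le_one_of_one_le₀ (by linarith)
  have hcD : c * (2 * s * D - 1) = 1 := inv_mul_cancel₀ (by linarith)
  let τ : DensityOp ι :=
    { mat := (c : ℂ) • (((2 * s : ℝ) : ℂ) • (1 : Matrix ι ι ℂ) - ρ.mat)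
      posSemidef := posSemidef_ofReal_smul hρ hc0.le
      trace_eq_one := by
        rw [trace_smul, trace_sub, trace_smul, ρ.trace_eq_one, trace_one, smul_eq_mul, smul_eq_mul]
        exact_mod_cast hcD }
  let ω : DensityOp ι :=
    { mat := ((1 / 2 : ℝ) : ℂ) • (ρ.mat + τ.mat)
      posSemidef := posSemidef_ofReal_smul (ρ.posSemidef.add τ.posSemidef) (by norm_num)
      trace_eq_one := by
        rw [trace_smul, trace_add, ρ.trace_eq_one, τ.trace_eq_one]
        norm_num }
  have hω : t ≤ ω.minEntropy := by
    rw [DensityOp.le_minEntropy_iff]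
    -- The gap `s - ω` is a multiple of `2s - ρ`, nonnegative because `c ≤ 1`.
    have e : ((2 : ℝ) ^ (-t) : ℝ) • (1 : Matrix ι ι ℂ) - ω.mat = (((1 / 2) * (1 - c) : ℝ) : ℂ) •
        (((2 * s : ℝ) : ℂ) • (1 : Matrix ι ι ℂ) - ρ.mat) := by
      rw [← hs]
      ext i j
      simp only [ω, τ, Matrix.smul_apply, Matrix.sub_apply, Matrix.add_apply, smul_eq_mul,
        Complex.real_smul]
      push_cast
      ring
    have e' := posSemidef_ofReal_smul hρ (c := (1 / 2) * (1 - c)) (by linarith)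
    rw [← e] at e'
    exact e'
  let I : Interpretation ω 2 :=
    { p := fun _ => 1 / 2
      σ := ![ρ, τ]
      p_pos := by intro; norm_num
      p_sum := by simp
      mixture := by simp [Fin.sum_univ_two, ω, smul_add] }
  obtain ⟨P, hP, hP', hPH⟩ := exists_re_trace_mul_eq_trNorm
    (E.isHermitian_sub_maxMixed ρ) (E.trace_sub_maxMixed ρ)
  have hnn : 0 ≤ trNorm (E.map ρ.mat - maxMixed κ) :=
    (abs_nonneg _).trans (abs_re_trace_mul_le_trNorm hP hP' (E.isHermitian_sub_maxMixed ρ)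
      (E.trace_sub_maxMixed ρ))
  have hone : (1 : Matrix ι ι ℂ) = (D : ℂ) • maxMixed ι := by
    have : (Fintype.card ι : ℂ) ≠ 0 := by exact_mod_cast Fintype.card_ne_zero
    simp [maxMixed, hD, smul_smul, this]
  have hτ : E.map τ.mat = maxMixed κ - (c : ℂ) • (E.map ρ.mat - maxMixed κ) := by
    have h1 : E.map τ.mat
        = (c : ℂ) • (((2 * s : ℝ) : ℂ) • (D : ℂ) • maxMixed κ - E.map ρ.mat) := by
      simp only [τ]
      rw [map_smul, map_sub, map_smul, hone, map_smul, hE]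
    have h2 : (c : ℂ) * (2 * s * D - 1) = 1 := by exact_mod_cast hcD
    rw [h1]
    ext i j
    simp only [Matrix.smul_apply, Matrix.sub_apply, smul_eq_mul]
    push_cast
    linear_combination (maxMixed κ i j) * h2
  have hω' : E.map ω.mat = ((1 / 2 : ℝ) : ℂ) • (E.map ρ.mat + E.map τ.mat) := by
    simp only [ω, map_smul, map_add]
  set Δ := E.map ρ.mat - maxMixed κ with hΔ
  have hρΔ : E.map ρ.mat = maxMixed κ + Δ := by rw [hΔ]; abel
  -- No function of the state separates `τ` from `ρ` if they coincide; but then `Δ = -c Δ` vanishes,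
  -- and only `0 < ε` is needed, which any instance of security gives.
  by_cases hne : τ = ρ
  · have hz : Δ = 0 := by
      rw [hne, hρΔ] at hτ
      have h0 : ((1 + c : ℝ) : ℂ) • Δ = 0 := by
        rw [Complex.ofReal_add, add_smul, Complex.ofReal_one, one_smul]
        have : Δ = - ((c : ℂ) • Δ) := by
          rw [sub_eq_add_neg] at hτ
          exact add_left_cancel hτ
        nth_rewrite 1 [this]
        abel
      refine (smul_eq_zero.mp h0).resolve_left ?_
      exact_mod_cast (by linarith : (1 + c : ℝ) ≠ 0)
    have hb := h ω hω 2 I Bool (POVM.ofEffect P hP hP') (fun _ => true)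
    have := (abs_nonneg _).trans_lt hb
    rw [← hPH, hz]
    simpa using this
  · classical
    have hb := h ω hω 2 I Bool (POVM.ofEffect P hP hP') (fun σ => decide (σ = ρ))
    -- `E ρ` and `E τ` differ from `E ω` by `± (1 + c) / 2 • Δ`, and `tr ((1 - P) Δ) = - tr (P Δ)`.
    have hq : trNorm Δ * ((1 + c) / 2) < ε := by
      refine lt_of_eq_of_lt ?_ ((le_abs_self _).trans_lt hb)
      have htr : Δ.trace.re = 0 := by rw [hΔ, E.trace_sub_maxMixed ρ, Complex.zero_re]
      rw [← hPH]
      simp only [I, Fin.sum_univ_two, Matrix.cons_val_zero, Matrix.cons_val_one, hω', hτ, hρΔ,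
        POVM.prob, POVM.ofEffect, hne]
      simp [mul_add, mul_sub, sub_mul, trace_add, trace_sub, htr]
      ring
    nlinarith

/-- The main estimate: an event of the ensemble cannot be correlated with an effect. -/
lemma Indistinguishable.abs_sum_lt {E : Channel ι κ}
    (hE : E.map (maxMixed ι) = maxMixed κ) {t δ : ℝ}
    (ht : 2 ≤ (2 : ℝ) ^ (-t) * Fintype.card ι) (h : Indistinguishable E (t - 1) δ)
    {ρ : DensityOp ι} (hρ : t ≤ ρ.minEntropy) {N : ℕ} (I : Interpretation ρ N)
    (s : Finset (Fin N)) {A : Matrix κ κ ℂ} (hA : A.PosSemidef) (hA' : (1 - A).PosSemidef) :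
    |∑ i ∈ s, I.p i * (A * (E.map (I.σ i).mat - maxMixed κ)).trace.re| < δ := by
  have := ρ.nonempty
  rw [DensityOp.le_minEntropy_iff] at hρ
  have hD : (0 : ℝ) < Fintype.card ι := by exact_mod_cast Fintype.card_pos
  set q : ℝ := ∑ i ∈ s, I.p i with hq
  have hq0 : 0 ≤ q := Finset.sum_nonneg fun i _ => (I.p_pos i).le
  have hq1 : q ≤ 1 := by
    rw [← I.p_sum]
    exact Finset.sum_le_univ_sum_of_nonneg fun i => (I.p_pos i).le
  have hpart (r : Finset (Fin N)) : (∑ i ∈ r, (I.p i : ℂ) • (I.σ i).mat).PosSemidef :=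
    posSemidef_sum r fun i _ => posSemidef_ofReal_smul (I.σ i).posSemidef (I.p_pos i).le
  -- The missing mass `1 - q` is filled with the maximally mixed state, which drops out of `E ω -
  -- I/d`.
  let ω : DensityOp ι :=
    { mat := ∑ i ∈ s, (I.p i : ℂ) • (I.σ i).mat + ((1 - q : ℝ) : ℂ) • maxMixed ι
      posSemidef := (hpart s).add (posSemidef_ofReal_smul maxMixed_posSemidef (by linarith))
      trace_eq_one := by
        rw [trace_add, trace_sum, trace_smul, trace_maxMixed]
        simp_rw [trace_smul, (I.σ _).trace_eq_one]
        simp [hq] }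
  have hω : t - 1 ≤ ω.minEntropy := by
    rw [DensityOp.le_minEntropy_iff, two_rpow_neg_sub_one]
    -- The sub-ensemble and the padding are each at most `2 ^ (-t)`; their sum loses one bit of
    -- entropy.
    have hr : (0 : ℝ) ≤ 2 ^ (-t) - (1 - q) * (Fintype.card ι : ℝ)⁻¹ := by
      have h1 : (Fintype.card ι : ℝ)⁻¹ ≤ 2 ^ (-t) := by
        rw [inv_le_iff_one_le_mul₀ hD]
        linarith
      nlinarith [inv_pos.mpr hD]
    have hsum := (hρ.add (hpart sᶜ)).add
      (posSemidef_ofReal_smul (PosSemidef.one (n := ι) (R := ℂ)) hr)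
    convert hsum using 1
    have e := I.mixture
    rw [← Finset.sum_add_sum_compl s] at e
    rw [← e]
    ext i j
    simp only [ω, maxMixed, Matrix.add_apply, Matrix.sub_apply, Matrix.smul_apply, smul_eq_mul]
    push_cast
    ring
  have hmap : E.map ω.mat - maxMixed κ
      = ∑ i ∈ s, (I.p i : ℂ) • (E.map (I.σ i).mat - maxMixed κ) := by
    simp only [ω, map_add, map_sum, map_smul, hE, smul_sub, Finset.sum_sub_distrib,
      ← Finset.sum_smul]
    rw [← Complex.ofReal_sum, ← hq]
    push_cast
    rw [sub_smul, one_smul]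
    abel
  have hb := (abs_re_trace_mul_le_trNorm hA hA' (E.isHermitian_sub_maxMixed ω)
    (E.trace_sub_maxMixed ω)).trans_lt (h ω hω)
  rw [hmap, Finset.mul_sum, trace_sum, Complex.re_sum] at hb
  simpa using hb

theorem Indistinguishable.stronglyEntropicallySecure {E : Channel ι κ}
    (hE : E.map (maxMixed ι) = maxMixed κ) {t ε : ℝ}
    (ht : 2 ≤ (2 : ℝ) ^ (-t) * Fintype.card ι) (h : Indistinguishable E (t - 1) (ε / 8)) :
    StronglyEntropicallySecure E t ε := by
  classical
  intro ρ hρ N I Z _ A f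
  have hρ' : trNorm (E.map ρ.mat - maxMixed κ) < ε / 8 := h ρ (by linarith)
  set G : Fin N → Matrix κ κ ℂ := fun i => E.map (I.σ i).mat - maxMixed κ with hG
  have hsets : |∑ i, I.p i * A.prob (G i) (f (I.σ i))| ≤ ε / 2 := by
    have hsub (S : Finset Z) :
        |∑ i, I.p i * (if f (I.σ i) ∈ S then ∑ z ∈ S, A.prob (G i) z else 0)| ≤ ε / 8 := by
      have hS := h.abs_sum_lt hE ht hρ I (Finset.univ.filter fun i => f (I.σ i) ∈ S)
        (A.sum_posSemidef S) (A.one_sub_sum_posSemidef S)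
      refine le_of_eq_of_le ?_ hS.le
      rw [Finset.sum_filter]
      congr 1
      refine Finset.sum_congr rfl fun i _ => ?_
      split_ifs
      · rw [Finset.sum_mul, trace_sum, Complex.re_sum]
        rfl
      · simp
    -- The deviations are traceless, so only the diagonal term `z = f (σ i)` survives the averaging.
    have hzero (i : Fin N) : ∑ z, A.prob (G i) z = 0 := by
      simp only [POVM.prob]
      rw [← Complex.re_sum, ← trace_sum, ← Finset.sum_mul, A.sum_eq_one, one_mul,
        E.trace_sub_maxMixed, Complex.zero_re]
    have hcomm : 4 * ∑ S : Finset Z,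
          ∑ i, I.p i * (if f (I.σ i) ∈ S then ∑ z ∈ S, A.prob (G i) z else 0)
        = 2 ^ Fintype.card Z * ∑ i, I.p i * A.prob (G i) (f (I.σ i)) := by
      rw [Finset.sum_comm, Finset.mul_sum, Finset.mul_sum]
      refine Finset.sum_congr rfl fun i _ => ?_
      have := sum_finset_ite_mem_sum (f (I.σ i)) (A.prob (G i))
      rw [hzero, zero_add] at this
      rw [← Finset.mul_sum]
      linear_combination I.p i * this
    have htot := (Finset.abs_sum_le_sum_abs _ _).trans
      (Finset.sum_le_sum fun (S : Finset Z) (_ : S ∈ Finset.univ) => hsub S)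
    rw [Finset.sum_const, Finset.card_univ, Fintype.card_finset, nsmul_eq_mul] at htot
    push_cast at htot
    have hpow : (0 : ℝ) < 2 ^ Fintype.card Z := by positivity
    have h4 := congrArg abs hcomm
    rw [abs_mul, abs_mul, abs_of_pos hpow, abs_of_pos (four_pos : (0 : ℝ) < 4)] at h4
    refine le_of_mul_le_mul_left ?_ hpow
    linarith
  have hmix : |∑ i, I.p i * A.prob (E.map ρ.mat - maxMixed κ) (f (I.σ i))| ≤ ε / 8 := by
    -- Here the state does not depend on `i`, so the POVM elements merge into a single effect and no
    -- averaging is needed.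
    have hW : (∑ i, (I.p i : ℂ) • A.elem (f (I.σ i))).PosSemidef :=
      posSemidef_sum _ fun i _ => posSemidef_ofReal_smul (A.posSemidef _) (I.p_pos i).le
    have hW' : (1 - ∑ i, (I.p i : ℂ) • A.elem (f (I.σ i))).PosSemidef := by
      have h1 : (1 : Matrix κ κ ℂ) - ∑ i, (I.p i : ℂ) • A.elem (f (I.σ i))
          = ∑ i, (I.p i : ℂ) • (1 - A.elem (f (I.σ i))) := by
        simp only [smul_sub, Finset.sum_sub_distrib, ← Finset.sum_smul]
        rw [← Complex.ofReal_sum, I.p_sum, Complex.ofReal_one, one_smul]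
      rw [h1]
      refine posSemidef_sum _ fun i _ => posSemidef_ofReal_smul ?_ (I.p_pos i).le
      simpa using A.one_sub_sum_posSemidef {f (I.σ i)}
    have hb := (abs_re_trace_mul_le_trNorm hW hW' (E.isHermitian_sub_maxMixed ρ)
      (E.trace_sub_maxMixed ρ)).trans hρ'.le
    rw [Finset.sum_mul, trace_sum, Complex.re_sum] at hb
    simpa [POVM.prob] using hb
  -- The empty event forces `ε > 0`, which makes the final bound `ε / 2 + ε / 8 < ε` strict.
  have hε : 0 < ε / 8 := (abs_nonneg _).trans_lt
    (h.abs_sum_lt hE ht hρ I ∅ (PosSemidef.one (n := κ) (R := ℂ)) (by simp [PosSemidef.zero]))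
  have hsplit : ∑ i, I.p i * A.prob (E.map (I.σ i).mat) (f (I.σ i))
      - ∑ i, I.p i * A.prob (E.map ρ.mat) (f (I.σ i))
      = ∑ i, I.p i * A.prob (G i) (f (I.σ i))
        - ∑ i, I.p i * A.prob (E.map ρ.mat - maxMixed κ) (f (I.σ i)) := by
    rw [← Finset.sum_sub_distrib, ← Finset.sum_sub_distrib]
    refine Finset.sum_congr rfl fun i _ => ?_
    rw [hG, POVM.prob_sub, POVM.prob_sub]
    ring
  rw [hsplit]
  refine (abs_sub _ _).trans_lt ?_
  linarith

end Security

end QEntropic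

theorem mainTheorem1 (n : ℕ) {κ : Type*} [Fintype κ] [DecidableEq κ]
    (E : QEntropic.Channel (Fin (2 ^ n)) κ)
    (hE : E.map (QEntropic.maxMixed (Fin (2 ^ n))) = QEntropic.maxMixed κ)
    (t ε : ℝ) (ht : t ≤ (n : ℝ) - 1) :
    (QEntropic.StronglyEntropicallySecure E t ε →
        QEntropic.Indistinguishable E (t - 1) (2 * ε)) ∧
      (QEntropic.Indistinguishable E (t - 1) (ε / 8) →
        QEntropic.StronglyEntropicallySecure E t ε) := by
  -- The hypothesis `t ≤ n - 1` enters only in this form.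
  have hcard : 2 ≤ (2 : ℝ) ^ (-t) * Fintype.card (Fin (2 ^ n)) := by
    rw [Fintype.card_fin, Nat.cast_pow, Nat.cast_ofNat, ← Real.rpow_natCast,
      ← Real.rpow_add two_pos]
    calc (2 : ℝ) = 2 ^ (1 : ℝ) := (Real.rpow_one 2).symm
      _ ≤ 2 ^ (-t + n) := Real.rpow_le_rpow_of_exponent_le one_le_two (by linarith)
  exact ⟨fun h => h.indistinguishable hE hcard, fun h => h.stronglyEntropicallySecure hE hcard⟩
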